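/- Let $M_n$ denote the complex $n\times n$ matrices and let $k,m$ be positive integers with $\gcd(k,m)=1$. Let $T:M_k\to M_m$ be a positive map, i.e. a complex-linear map sending positive semidefinite Hermitian matrices to positive semidefinite Hermitian matrices. Then the following are equivalent: (a) $T$ is equivalent to a doubly stochastic map: there are invertible matrices $X'\in M_k$, $Y'\in M_m$ such that the map $S(X)=Y'\,T(X'XX'^*)\,Y'^*$ is positive and satisfies $S\big(\tfrac{1}{\sqrt k}\mathrm{Id}\big)=\tfrac{1}{\sqrt m}\mathrm{Id}$ and $S^*\big(\tfrac{1}{\sqrt m}\mathrm{Id}\big)=\tfrac{1}{\sqrt k}\mathrm{Id}$; (b) $T$ has support, and $T(\mathrm{Id})$ and $T^*(\mathrm{Id})$ are positive definite Hermitian matrices. Here $T^*$ and $S^*$ are the adjoints with respect to the trace inner product $\langle A,B\rangle=\mathrm{tr}(AB^*)$. The map $T$ has support if for all orthonormal bases $v_1,\dots,v_k$ of $\mathbb C^k$ and $w_1,\dots,w_m$ of $\mathbb C^m$ the $k\times m$ matrix $A=\big(\mathrm{tr}(T(v_iv_i^*)\,w_jw_j^*)\big)_{i,j}$ has support. A $k\times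 m$ matrix $A$ has support if the square matrix $C=A\otimes 1_{m\times k}$ (Kronecker product) of order $km$ has support, where $1_{m\times k}$ is the $m\times k$ matrix with all entries equal to $1$. A square matrix $C=(c_{ij})$ of order $n$ has support if there is a permutation $\sigma$ of $\{1,\dots,n\}$ with $\prod_{i=1}^n c_{i\sigma(i)}\neq 0$. -/

import Mathlib

open scoped Matrix Kronecker ComplexOrder

namespace PosMap

/-- A linear map `M_k → M_m` is positive if it sends positive semidefinite Hermitian matrices to
positive semidefinite Hermitian matrices. -/
def IsPositive {k m : ℕ}
    (T : Matrix (Fin k) (Fin k) ℂ →ₗ[ℂ] Matrix (Fin m) (Fin m) ℂ) : Prop :=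
  ∀ X : Matrix (Fin k) (Fin k) ℂ, X.PosSemidef → (T X).PosSemidef

/-- The adjoint `T*` with respect to the trace inner product `⟨A, B⟩ = tr (A B*)`. Its `(i, j)`
entry at `Y` is `⟨Y, T E_ij⟩`, where `E_ij` is the matrix unit; the characteristic property is
`trace_adjoint` below and it determines `T*` uniquely (`eq_adjoint`). -/
noncomputable def adjoint {k m : ℕ}
    (T : Matrix (Fin k) (Fin k) ℂ →ₗ[ℂ] Matrix (Fin m) (Fin m) ℂ) :
    Matrix (Fin m) (Fin m) ℂ →ₗ[ℂ] Matrix (Fin k) (Fin k) ℂ where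
  toFun Y := Matrix.of fun i j => (Y * (T (Matrix.single i j 1))ᴴ).trace
  map_add' Y Z := by ext i j; simp [add_mul]
  map_smul' c Y := by ext i j; simp

theorem trace_adjoint {k m : ℕ}
    (T : Matrix (Fin k) (Fin k) ℂ →ₗ[ℂ] Matrix (Fin m) (Fin m) ℂ)
    (X : Matrix (Fin k) (Fin k) ℂ) (Y : Matrix (Fin m) (Fin m) ℂ) :
    (T X * Yᴴ).trace = (X * (adjoint T Y)ᴴ).trace := by
  have key : ∀ i j, (T (Matrix.single i j 1) * Yᴴ).trace
      = (Matrix.single i j 1 * (adjoint T Y)ᴴ).trace := by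
    intro i j
    rw [Matrix.trace_single_mul, ← Matrix.conjTranspose_conjTranspose (T (Matrix.single i j 1)),
      ← Matrix.conjTranspose_mul, Matrix.trace_conjTranspose]
    simp [adjoint]
  have h : (Matrix.traceLinearMap (Fin m) ℂ ℂ ∘ₗ LinearMap.mulRight ℂ Yᴴ ∘ₗ T)
      = Matrix.traceLinearMap (Fin k) ℂ ℂ ∘ₗ LinearMap.mulRight ℂ (adjoint T Y)ᴴ := by
    apply Matrix.ext_linearMap
    intro i j
    ext
    simpa using key i j
  simpa using LinearMap.congr_fun h X

theorem eq_adjoint {k m : ℕ}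
    (T : Matrix (Fin k) (Fin k) ℂ →ₗ[ℂ] Matrix (Fin m) (Fin m) ℂ)
    (Y : Matrix (Fin m) (Fin m) ℂ) (Z : Matrix (Fin k) (Fin k) ℂ)
    (h : ∀ X : Matrix (Fin k) (Fin k) ℂ, (T X * Yᴴ).trace = (X * Zᴴ).trace) :
    Z = adjoint T Y := by
  ext i j
  have h1 := (h (Matrix.single i j 1)).symm.trans (trace_adjoint T (Matrix.single i j 1) Y)
  simp only [Matrix.trace_single_mul, Matrix.conjTranspose_apply] at h1
  exact star_injective (by simpa using h1)

/-- A positive map `T : M_k → M_m` is doubly stochastic if `T (Id/√k) = Id/√m` and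
`T* (Id/√m) = Id/√k`. -/
def IsDoublyStochastic {k m : ℕ}
    (T : Matrix (Fin k) (Fin k) ℂ →ₗ[ℂ] Matrix (Fin m) (Fin m) ℂ) : Prop :=
  IsPositive T ∧
    T (((Real.sqrt k : ℝ) : ℂ)⁻¹ • 1) = ((Real.sqrt m : ℝ) : ℂ)⁻¹ • 1 ∧
    adjoint T (((Real.sqrt m : ℝ) : ℂ)⁻¹ • 1) = ((Real.sqrt k : ℝ) : ℂ)⁻¹ • 1

/-- `T` and `T₁` are equivalent if `T₁ X = Y' T(X' X X'*) Y'*` for some invertible `X'`, `Y'`. -/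
def Equivalent {k m : ℕ}
    (T T₁ : Matrix (Fin k) (Fin k) ℂ →ₗ[ℂ] Matrix (Fin m) (Fin m) ℂ) : Prop :=
  ∃ (X' : Matrix (Fin k) (Fin k) ℂ) (Y' : Matrix (Fin m) (Fin m) ℂ),
    IsUnit X' ∧ IsUnit Y' ∧
      ∀ X : Matrix (Fin k) (Fin k) ℂ, T₁ X = Y' * T (X' * X * X'ᴴ) * Y'ᴴ

/-- A square matrix has support if `∏ i, a_{i σ(i)} ≠ 0` for some permutation `σ`. -/
def SquareHasSupport {n : ℕ} (A : Matrix (Fin n) (Fin n) ℂ) : Prop :=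
  ∃ σ : Equiv.Perm (Fin n), ∏ i, A i (σ i) ≠ 0

/-- The Kronecker product `A ⊗ 1_{m×k}` of a `k × m` matrix with the all-ones `m × k` matrix,
as a square matrix of order `k * m` (indices in the usual lexicographic order). -/
def kroneckerOnes {k m : ℕ} (A : Matrix (Fin k) (Fin m) ℂ) :
    Matrix (Fin (k * m)) (Fin (k * m)) ℂ :=
  Matrix.reindex finProdFinEquiv (finProdFinEquiv.trans (finCongr (Nat.mul_comm m k)))
    (A ⊗ₖ (Matrix.of fun (_ : Fin m) (_ : Fin k) => (1 : ℂ)))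

/-- A `k × m` matrix `A` has support if the square matrix `A ⊗ 1_{m×k}` has support. -/
def RectHasSupport {k m : ℕ} (A : Matrix (Fin k) (Fin m) ℂ) : Prop :=
  SquareHasSupport (kroneckerOnes A)

/-- `T : M_k → M_m` has support if for all orthonormal bases `v` of `ℂ^k` and `w` of `ℂ^m` the
`k × m` matrix with entries `tr (T(v_i v_i*) w_j w_j*)` has support. -/
def HasSupport {k m : ℕ}
    (T : Matrix (Fin k) (Fin k) ℂ →ₗ[ℂ] Matrix (Fin m) (Fin m) ℂ) : Prop :=
  ∀ (v : OrthonormalBasis (Fin k) ℂ (EuclideanSpace ℂ (Fin k)))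
    (w : OrthonormalBasis (Fin m) ℂ (EuclideanSpace ℂ (Fin m))),
    RectHasSupport (Matrix.of fun (i : Fin k) (j : Fin m) =>
      (T (Matrix.vecMulVec (v i).ofLp (star (v i).ofLp)) *
        Matrix.vecMulVec (w j).ofLp (star (w j).ofLp)).trace)

end PosMap

namespace PosMap

/-! For orthonormal bases `v`, `w` the overlaps tr(T(v_i v_i*) w_j w_j*) form a nonnegative k × m
matrix. Support means that some bijection σ from k × m to m × k sends each (i, ·) to a (j, ·) with
positive overlap: an integral transport plan with row masses m and column masses k.

Doubly stochastic implies support: for a doubly stochastic S these matrices have row sums √(m/k) and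
column sums √(k/m), so a zero block obeys Hall's inequality. Stated for ranks of positive
semidefinite P, Q with tr(S(P)Q) = 0, the inequality survives congruence, so it passes to T, and
Hall's theorem gives σ (`Equivalent.hasSupport`). Positivity of T(1) and T*(1) follows from support.

Support implies scalable: minimise det T(X) over positive definite X with det X = 1. In the
eigenbases of X and T(X), support bounds log μ_j - log λ_i below along σ, uniformly by compactness
of the set of bases. These differences sum to k log det T(X), so a bound on det T(X) bounds each of
them above too. Coprimality makes the bipartite graph of σ connected (`exists_shared_column`), so
the log λ_i stay close to one another; having sum zero, they are bounded
(`HasSupport.exists_eigenvalues_le`). Hence a minimiser Z exists. Normalising Z and T(Z) to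
identities by congruence, the first-order condition at the identity makes the adjoint image of the
identity scalar (`adjoint_one_of_det_le`). -/

/-! ### Rank-one projections, spectral sums and overlaps -/

/-- The rank-one matrix `x x*`. -/
noncomputable def proj {n : ℕ} (x : EuclideanSpace ℂ (Fin n)) : Matrix (Fin n) (Fin n) ℂ :=
  Matrix.vecMulVec x.ofLp (star x.ofLp)

/-- The real number `tr (T(x x*) y y*)`. -/
noncomputable def overlap {k m : ℕ}
    (T : Matrix (Fin k) (Fin k) ℂ →ₗ[ℂ] Matrix (Fin m) (Fin m) ℂ)
    (x : EuclideanSpace ℂ (Fin k)) (y : EuclideanSpace ℂ (Fin m)) : ℝ :=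
  (T (proj x) * proj y).trace.re

theorem posSemidef_proj {n : ℕ} (x : EuclideanSpace ℂ (Fin n)) : (proj x).PosSemidef :=
  Matrix.posSemidef_vecMulVec_self_star _

theorem sum_smul_proj {n : ℕ} (v : OrthonormalBasis (Fin n) ℂ (EuclideanSpace ℂ (Fin n)))
    (d : Fin n → ℂ) :
    ∑ i, d i • proj (v i) = (Matrix.of fun a i => v i a) * Matrix.diagonal d *
      (Matrix.of fun a i => v i a)ᴴ := by
  ext a b
  rw [Matrix.mul_apply]
  simp [proj, Matrix.sum_apply, Matrix.vecMulVec_apply]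
  refine Finset.sum_congr rfl fun i _ => by ring

theorem conjTranspose_mul_self_basis {n : ℕ}
    (v : OrthonormalBasis (Fin n) ℂ (EuclideanSpace ℂ (Fin n))) :
    (Matrix.of fun a i => v i a)ᴴ * (Matrix.of fun a i => v i a) =
      (1 : Matrix (Fin n) (Fin n) ℂ) := by
  ext i j
  have h := (orthonormal_iff_ite.mp v.orthonormal) i j
  rw [EuclideanSpace.inner_eq_star_dotProduct] at h
  rw [Matrix.mul_apply, Matrix.one_apply, ← h]
  simp [dotProduct, mul_comm]

theorem self_mul_conjTranspose_basis {n : ℕ}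
    (v : OrthonormalBasis (Fin n) ℂ (EuclideanSpace ℂ (Fin n))) :
    (Matrix.of fun a i => v i a) * (Matrix.of fun a i => v i a)ᴴ =
      (1 : Matrix (Fin n) (Fin n) ℂ) :=
  mul_eq_one_comm.mp (conjTranspose_mul_self_basis v)

theorem sum_proj {n : ℕ} (v : OrthonormalBasis (Fin n) ℂ (EuclideanSpace ℂ (Fin n))) :
    ∑ i, proj (v i) = 1 := by
  have h := sum_smul_proj v (fun _ => 1)
  simpa [self_mul_conjTranspose_basis] using h

theorem eq_sum_eigenvalues_smul_proj {n : ℕ} {A : Matrix (Fin n) (Fin n) ℂ}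
    (hA : A.IsHermitian) :
    A = ∑ i, (hA.eigenvalues i : ℂ) • proj (hA.eigenvectorBasis i) := by
  rw [sum_smul_proj]
  conv_lhs => rw [hA.spectral_theorem, Unitary.conjStarAlgAut_apply]
  rfl

/-- Turns the size of a zero block into a rank, which congruence by invertible matrices preserves.
-/
theorem rank_sum_proj {n : ℕ} (v : OrthonormalBasis (Fin n) ℂ (EuclideanSpace ℂ (Fin n)))
    (I : Finset (Fin n)) : (∑ i ∈ I, proj (v i)).rank = I.card := by
  classical
  have h : ∑ i ∈ I, proj (v i) = ∑ i, (if i ∈ I then (1 : ℂ) else 0) • proj (v i) := by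
    simp [Finset.sum_ite_mem, ite_smul]
  have h1 : IsUnit (Matrix.of fun a i => v i a : Matrix (Fin n) (Fin n) ℂ) :=
    IsUnit.of_mul_eq_one _ (self_mul_conjTranspose_basis v)
  have h2 : IsUnit (Matrix.of fun a i => v i a : Matrix (Fin n) (Fin n) ℂ)ᴴ :=
    IsUnit.of_mul_eq_one _ (conjTranspose_mul_self_basis v)
  rw [h, sum_smul_proj, Matrix.rank_mul_eq_left_of_isUnit_det _ _
    ((Matrix.isUnit_iff_isUnit_det _).mp h2),
    Matrix.rank_mul_eq_right_of_isUnit_det _ _ ((Matrix.isUnit_iff_isUnit_det _).mp h1),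
    Matrix.rank_diagonal, Fintype.card_subtype]
  simp

theorem trace_mul_proj {n : ℕ} (A : Matrix (Fin n) (Fin n) ℂ) (y : EuclideanSpace ℂ (Fin n)) :
    (A * proj y).trace = star y.ofLp ⬝ᵥ (A *ᵥ y.ofLp) := by
  rw [proj, Matrix.mul_vecMulVec, Matrix.trace_vecMulVec, dotProduct_comm]

theorem trace_mul_proj_eigenvectorBasis {n : ℕ} {A : Matrix (Fin n) (Fin n) ℂ}
    (hA : A.IsHermitian) (j : Fin n) :
    (A * proj (hA.eigenvectorBasis j)).trace.re = hA.eigenvalues j := by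
  rw [trace_mul_proj, hA.eigenvalues_eq]
  rfl

theorem trace_mul_nonneg {n : ℕ} {A B : Matrix (Fin n) (Fin n) ℂ} (hA : A.PosSemidef)
    (hB : B.PosSemidef) : 0 ≤ (A * B).trace := by
  rw [eq_sum_eigenvalues_smul_proj hB.1, Matrix.mul_sum, Matrix.trace_sum]
  refine Finset.sum_nonneg fun i _ => ?_
  rw [Matrix.mul_smul, Matrix.trace_smul, trace_mul_proj]
  exact mul_nonneg (by exact_mod_cast hB.eigenvalues_nonneg i) (hA.dotProduct_mulVec_nonneg _)

variable {k m : ℕ} {T : Matrix (Fin k) (Fin k) ℂ →ₗ[ℂ] Matrix (Fin m) (Fin m) ℂ}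

theorem coe_overlap (hT : IsPositive T) (x : EuclideanSpace ℂ (Fin k))
    (y : EuclideanSpace ℂ (Fin m)) : (overlap T x y : ℂ) = (T (proj x) * proj y).trace := by
  have h := Complex.nonneg_iff.mp (trace_mul_nonneg (hT _ (posSemidef_proj x)) (posSemidef_proj y))
  exact Complex.ext (by simp [overlap]) (by simpa using h.2)

theorem overlap_nonneg (hT : IsPositive T) (x : EuclideanSpace ℂ (Fin k))
    (y : EuclideanSpace ℂ (Fin m)) : 0 ≤ overlap T x y :=
  (Complex.nonneg_iff.mp
    (trace_mul_nonneg (hT _ (posSemidef_proj x)) (posSemidef_proj y))).1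

theorem trace_map_mul_proj {X : Matrix (Fin k) (Fin k) ℂ} (hX : X.IsHermitian)
    (y : EuclideanSpace ℂ (Fin m)) :
    (T X * proj y).trace.re = ∑ i, hX.eigenvalues i * overlap T (hX.eigenvectorBasis i) y := by
  conv_lhs => rw [eq_sum_eigenvalues_smul_proj hX]
  simp [overlap, Matrix.sum_mul, Matrix.trace_sum, Complex.re_sum]

theorem trace_map_mul {X : Matrix (Fin k) (Fin k) ℂ} (hX : X.IsHermitian)
    {Y : Matrix (Fin m) (Fin m) ℂ} (hY : Y.IsHermitian) :
    (T X * Y).trace.re = ∑ j, ∑ i, hX.eigenvalues i * hY.eigenvalues j *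
      overlap T (hX.eigenvectorBasis i) (hY.eigenvectorBasis j) := by
  conv_lhs => rw [eq_sum_eigenvalues_smul_proj hY]
  simp only [Matrix.trace_sum, Complex.re_sum, Matrix.mul_smul,
    Matrix.trace_smul, smul_eq_mul, Complex.re_ofReal_mul, trace_map_mul_proj hX, Finset.mul_sum]
  refine Finset.sum_congr rfl fun j _ => Finset.sum_congr rfl fun i _ => by ring

theorem sum_overlap_right (w : OrthonormalBasis (Fin m) ℂ (EuclideanSpace ℂ (Fin m)))
    (x : EuclideanSpace ℂ (Fin k)) : ∑ j, overlap T x (w j) = (T (proj x)).trace.re := by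
  simp only [overlap]
  rw [← Complex.re_sum, ← Matrix.trace_sum, ← Matrix.mul_sum, sum_proj, mul_one]

theorem sum_overlap_left (v : OrthonormalBasis (Fin k) ℂ (EuclideanSpace ℂ (Fin k)))
    (y : EuclideanSpace ℂ (Fin m)) : ∑ i, overlap T (v i) y = (T 1 * proj y).trace.re := by
  simp only [overlap]
  rw [← Complex.re_sum, ← Matrix.trace_sum, ← Matrix.sum_mul, ← map_sum, sum_proj]

theorem trace_map_eq_trace_mul_adjoint_one
    (T : Matrix (Fin k) (Fin k) ℂ →ₗ[ℂ] Matrix (Fin m) (Fin m) ℂ)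
    (X : Matrix (Fin k) (Fin k) ℂ) : (T X).trace = (X * (adjoint T 1)ᴴ).trace := by
  simpa using trace_adjoint T X 1

/-! ### Support as a transport plan, and its uniformity over bases -/

/-- Support of a rectangular matrix, with the permutation written on pairs of indices. -/
theorem rectHasSupport_iff (A : Matrix (Fin k) (Fin m) ℂ) :
    RectHasSupport A ↔ ∃ σ : Fin k × Fin m ≃ Fin m × Fin k, ∀ x, A x.1 (σ x).1 ≠ 0 := by
  simp only [RectHasSupport, SquareHasSupport, kroneckerOnes, Finset.prod_ne_zero_iff]
  constructor
  · rintro ⟨σ, hσ⟩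
    refine ⟨finProdFinEquiv.trans (σ.trans
      (finProdFinEquiv.trans (finCongr (Nat.mul_comm m k))).symm), fun x => ?_⟩
    simpa using hσ (finProdFinEquiv x) (Finset.mem_univ _)
  · rintro ⟨σ, hσ⟩
    refine ⟨finProdFinEquiv.symm.trans (σ.trans
      (finProdFinEquiv.trans (finCongr (Nat.mul_comm m k)))), fun x _ => ?_⟩
    simpa using hσ (finProdFinEquiv.symm x)

theorem hasSupport_iff (hT : IsPositive T) :
    HasSupport T ↔ ∀ (v : OrthonormalBasis (Fin k) ℂ (EuclideanSpace ℂ (Fin k)))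
      (w : OrthonormalBasis (Fin m) ℂ (EuclideanSpace ℂ (Fin m))),
      ∃ σ : Fin k × Fin m ≃ Fin m × Fin k, ∀ x, 0 < overlap T (v x.1) (w (σ x).1) := by
  unfold HasSupport
  simp only [rectHasSupport_iff]
  refine forall_congr' fun v => forall_congr' fun w => exists_congr fun σ => forall_congr' fun x => ?_
  have h := coe_overlap hT (v x.1) (w (σ x).1)
  rw [(overlap_nonneg hT _ _).lt_iff_ne', ← Complex.ofReal_ne_zero, h]
  rfl

theorem isCompact_setOf_orthonormal (n : ℕ) :
    IsCompact {v : Fin n → EuclideanSpace ℂ (Fin n) | Orthonormal ℂ v} := by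
  refine Metric.isCompact_of_isClosed_isBounded ?_ ?_
  · simp only [orthonormal_iff_ite, Set.ofPred_forall]
    refine isClosed_iInter fun i => isClosed_iInter fun j => isClosed_eq ?_ continuous_const
    fun_prop
  · refine (Metric.isBounded_closedBall (x := 0) (r := 1)).subset fun v hv => ?_
    rw [mem_closedBall_zero_iff, pi_norm_le_iff_of_nonneg zero_le_one]
    exact fun i => (hv.1 i).le

theorem exists_orthonormalBasis_coe_eq {n : ℕ} {v : Fin n → EuclideanSpace ℂ (Fin n)}
    (hv : Orthonormal ℂ v) :
    ∃ b : OrthonormalBasis (Fin n) ℂ (EuclideanSpace ℂ (Fin n)), ⇑b = v := by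
  have h : Fintype.card (Fin n) = Module.finrank ℂ (EuclideanSpace ℂ (Fin n)) := by simp
  cases n with
  | zero => exact ⟨EuclideanSpace.basisFun (Fin 0) ℂ, Subsingleton.elim _ _⟩
  | succ n =>
    refine ⟨(basisOfOrthonormalOfCardEqFinrank hv h).toOrthonormalBasis ?_, ?_⟩ <;> simp [hv]

theorem continuous_proj (n : ℕ) :
    Continuous (proj : EuclideanSpace ℂ (Fin n) → Matrix (Fin n) (Fin n) ℂ) := by
  refine Continuous.matrix_vecMulVec ?_ ?_ <;> fun_prop

theorem continuous_overlap {α : Type*} [TopologicalSpace α]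
    (T : Matrix (Fin k) (Fin k) ℂ →ₗ[ℂ] Matrix (Fin m) (Fin m) ℂ)
    {f : α → EuclideanSpace ℂ (Fin k)} {g : α → EuclideanSpace ℂ (Fin m)}
    (hf : Continuous f) (hg : Continuous g) : Continuous fun a => overlap T (f a) (g a) :=
  Complex.continuous_re.comp <| Continuous.matrix_trace <| Continuous.mul
    (T.continuous_of_finiteDimensional.comp ((continuous_proj k).comp hf))
    ((continuous_proj m).comp hg)

/-- The maximum over `i` of the minimum over `j` is continuous and positive on `K`, so it has a
positive lower bound there, although the best `i` varies with the point. -/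
theorem exists_uniform_of_isCompact {α ι κ : Type*} [TopologicalSpace α] [Fintype ι] [Fintype κ]
    [Nonempty ι] [Nonempty κ] {K : Set α} (hK : IsCompact K) {f : ι → κ → α → ℝ}
    (hf : ∀ i j, Continuous (f i j)) (h : ∀ p ∈ K, ∃ i, ∀ j, 0 < f i j p) :
    ∃ δ : ℝ, 0 < δ ∧ ∀ p ∈ K, ∃ i, ∀ j, δ ≤ f i j p := by
  have hc : Continuous fun p => Finset.univ.sup' Finset.univ_nonempty fun i =>
      Finset.univ.inf' Finset.univ_nonempty fun j => f i j p :=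
    Continuous.finset_sup'_apply _ fun i _ => Continuous.finset_inf'_apply _ fun j _ => hf i j
  obtain ⟨δ, hδ, h'⟩ := hK.exists_forall_le' (a := 0) hc.continuousOn fun p hp => by
    simpa [Finset.lt_sup'_iff, Finset.lt_inf'_iff] using h p hp
  exact ⟨δ, hδ, fun p hp => by
    simpa [Finset.le_sup'_iff, Finset.le_inf'_iff] using h' p hp⟩

/-- By compactness of the set of orthonormal frames, support is uniform in the bases. -/
theorem HasSupport.exists_uniform [NeZero k] [NeZero m] (hT : IsPositive T) (hs : HasSupport T) :
    ∃ δ : ℝ, 0 < δ ∧ ∀ (v : OrthonormalBasis (Fin k) ℂ (EuclideanSpace ℂ (Fin k)))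
      (w : OrthonormalBasis (Fin m) ℂ (EuclideanSpace ℂ (Fin m))),
      ∃ σ : Fin k × Fin m ≃ Fin m × Fin k, ∀ x, δ ≤ overlap T (v x.1) (w (σ x).1) := by
  rw [hasSupport_iff hT] at hs
  have : Nonempty (Fin k × Fin m ≃ Fin m × Fin k) := ⟨Equiv.prodComm _ _⟩
  have hf : ∀ (σ : Fin k × Fin m ≃ Fin m × Fin k) (x : Fin k × Fin m),
      Continuous fun p : (Fin k → EuclideanSpace ℂ (Fin k)) × (Fin m → EuclideanSpace ℂ (Fin m)) =>
        overlap T (p.1 x.1) (p.2 (σ x).1) := fun σ x => by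
    exact continuous_overlap T ((continuous_apply _).comp continuous_fst)
      ((continuous_apply _).comp continuous_snd)
  have hpos : ∀ p ∈ {v : Fin k → EuclideanSpace ℂ (Fin k) | Orthonormal ℂ v} ×ˢ
      {w : Fin m → EuclideanSpace ℂ (Fin m) | Orthonormal ℂ w},
      ∃ σ : Fin k × Fin m ≃ Fin m × Fin k, ∀ x, 0 < overlap T (p.1 x.1) (p.2 (σ x).1) := by
    intro p hp
    obtain ⟨v, hv⟩ := exists_orthonormalBasis_coe_eq (Set.mem_prod.mp hp).1
    obtain ⟨w, hw⟩ := exists_orthonormalBasis_coe_eq (Set.mem_prod.mp hp).2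
    rw [← hv, ← hw]
    exact hs v w
  obtain ⟨δ, hδ, h⟩ := exists_uniform_of_isCompact
    ((isCompact_setOf_orthonormal k).prod (isCompact_setOf_orthonormal m)) hf hpos
  exact ⟨δ, hδ, fun v w => h (⇑v, ⇑w) (Set.mem_prod.mpr ⟨v.orthonormal, w.orthonormal⟩)⟩

/-! ### Coprimality and connectedness of the transport plan -/

/-- For coprime `k` and `m`, a proper nonempty set of rows of a `k × m` transport plan shares a
column with its complement. -/
theorem exists_shared_column (hkm : Nat.Coprime k m) (σ : Fin k × Fin m ≃ Fin m × Fin k)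
    {I : Finset (Fin k)} (hI : I.Nonempty) (hI' : I ≠ Finset.univ) :
    ∃ x y, x.1 ∈ I ∧ y.1 ∉ I ∧ (σ x).1 = (σ y).1 := by
  classical
  by_contra! H
  set J : Finset (Fin m) := (I ×ˢ Finset.univ).image fun x => (σ x).1 with hJ
  -- With no shared column, `σ` carries the rows `I` exactly onto the columns `J`. Counting gives
  -- |I| m = |J| k, so k divides |I|, impossible for 0 < |I| < k.
  have h1 : (I ×ˢ (Finset.univ : Finset (Fin m))).map σ.toEmbedding = J ×ˢ Finset.univ := by
    ext z
    simp only [Finset.mem_map_equiv, Finset.mem_product, Finset.mem_univ, and_true]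
    constructor
    · intro hz
      exact Finset.mem_image.mpr ⟨σ.symm z, by simpa using hz, by simp⟩
    · intro hz
      obtain ⟨x, hx, hxz⟩ := Finset.mem_image.mp hz
      by_contra hc
      exact H x (σ.symm z) (by simpa using hx) hc (by simpa using hxz)
  have h2 := congrArg Finset.card h1
  simp only [Finset.card_map, Finset.card_product, Finset.card_univ, Fintype.card_fin] at h2
  have h3 : k ∣ I.card := hkm.dvd_of_dvd_mul_right ⟨J.card, by rw [h2, mul_comm]⟩
  have h4 : I.card < k := by
    simpa using Finset.card_lt_card (Finset.ssubset_univ_iff.mpr hI')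
  exact absurd (Nat.le_of_dvd hI.card_pos h3) (by omega)

/-- Two rows sharing a column have potentials within 2K of each other, and at most k such steps link
any two rows. -/
theorem sub_le_of_transport [NeZero m] (hkm : Nat.Coprime k m)
    (σ : Fin k × Fin m ≃ Fin m × Fin k)
    (a : Fin k → ℝ) (b : Fin m → ℝ) {K : ℝ} (hK : ∀ x, |b (σ x).1 - a x.1| ≤ K)
    (i j : Fin k) : a j - a i ≤ 2 * k * K := by
  classical
  have hK0 : 0 ≤ K := (abs_nonneg _).trans (hK (i, 0))
  set S : ℕ → Finset (Fin k) := fun n => Finset.univ.filter fun l => |a l - a i| ≤ 2 * n * K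
    with hS
  have hmem : ∀ n l, l ∈ S n ↔ |a l - a i| ≤ 2 * n * K := by simp [hS]
  have hi : ∀ n, i ∈ S n := by
    intro n
    rw [hmem, sub_self, abs_zero]
    positivity
  -- Until it contains every row, `S n` gains at least one with each step, through a column shared
  -- with its complement.
  have key : ∀ n, S n = Finset.univ ∨ n < (S n).card := by
    intro n
    induction n with
    | zero => exact Or.inr (Finset.card_pos.mpr ⟨i, hi 0⟩)
    | succ n ih =>
      have hmono : S n ⊆ S (n + 1) := by
        intro l hl
        rw [hmem] at hl ⊢
        push_cast
        linarith
      by_cases hu : S n = Finset.univ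
      · exact Or.inl (Finset.univ_subset_iff.mp (hu ▸ hmono))
      · obtain ⟨x, y, hx, hy, hxy⟩ := exists_shared_column hkm σ ⟨i, hi n⟩ hu
        have hy' : y.1 ∈ S (n + 1) := by
          rw [hmem] at hx ⊢
          have h1 := abs_le.mp (hK x)
          have h2 := abs_le.mp (hK y)
          have h3 := abs_le.mp hx
          rw [← hxy] at h2
          push_cast
          exact abs_le.mpr ⟨by linarith, by linarith⟩
        have h4 : (S n).card < (S (n + 1)).card :=
          Finset.card_lt_card ((Finset.ssubset_iff_of_subset hmono).mpr ⟨y.1, hy', hy⟩)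
        exact Or.inr (by have := ih.resolve_left hu; omega)
  have hk : S k = Finset.univ := (key k).resolve_right (by simpa using (S k).card_le_univ)
  exact (le_abs_self _).trans ((hmem k j).mp (hk ▸ Finset.mem_univ j))

/-! ### Positivity and coercivity from support -/

theorem re_det_eq_prod_eigenvalues {n : ℕ} {A : Matrix (Fin n) (Fin n) ℂ} (hA : A.IsHermitian) :
    A.det.re = ∏ i, hA.eigenvalues i := by
  rw [hA.det_eq_prod_eigenvalues]
  exact_mod_cast Complex.ofReal_re _

theorem HasSupport.posDef_map (hk : k ≠ 0) (hT : IsPositive T) (hs : HasSupport T)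
    {X : Matrix (Fin k) (Fin k) ℂ} (hX : X.PosDef) : (T X).PosDef := by
  have hY := hT X hX.posSemidef
  rw [hY.1.posDef_iff_eigenvalues_pos]
  intro j
  obtain ⟨σ, hσ⟩ := (hasSupport_iff hT).mp hs hX.1.eigenvectorBasis hY.1.eigenvectorBasis
  rw [← trace_mul_proj_eigenvectorBasis, trace_map_mul_proj hX.1]
  -- Surjectivity of `σ` provides a row with positive overlap in column `j`; the second index is
  -- arbitrary.
  have h := hσ (σ.symm (j, ⟨0, Nat.pos_of_ne_zero hk⟩))
  rw [Equiv.apply_symm_apply] at h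
  exact Finset.sum_pos' (fun i _ => mul_nonneg (hX.eigenvalues_pos i).le (overlap_nonneg hT _ _))
    ⟨_, Finset.mem_univ _, mul_pos (hX.eigenvalues_pos _) h⟩

/-- Over ℂ a real-valued quadratic form already forces the matrix to be Hermitian. -/
theorem posSemidef_of_dotProduct_mulVec_nonneg {n : ℕ} {A : Matrix (Fin n) (Fin n) ℂ}
    (h : ∀ x : Fin n → ℂ, 0 ≤ star x ⬝ᵥ (A *ᵥ x)) : A.PosSemidef := by
  rw [← Matrix.isPositive_toEuclideanLin_iff, LinearMap.isPositive_iff_complex]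
  intro x
  have hx := Complex.nonneg_iff.mp (h x.ofLp)
  have h1 : inner ℂ (A.toEuclideanLin x) x = star (star x.ofLp ⬝ᵥ (A *ᵥ x.ofLp)) := by
    rw [EuclideanSpace.inner_eq_star_dotProduct, Matrix.star_dotProduct, star_star,
      dotProduct_comm]
    rfl
  rw [h1]
  exact ⟨Complex.ext (by simp) (by simpa using hx.2.symm), by simpa using hx.1⟩

theorem posSemidef_adjoint_one (hT : IsPositive T) : (adjoint T 1).PosSemidef := by
  rw [← Matrix.posSemidef_conjTranspose_iff]
  refine posSemidef_of_dotProduct_mulVec_nonneg fun x => ?_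
  rw [← trace_mul_proj _ (WithLp.toLp 2 x), Matrix.trace_mul_comm,
    ← trace_map_eq_trace_mul_adjoint_one]
  exact (hT _ (posSemidef_proj _)).trace_nonneg

theorem HasSupport.posDef_adjoint_one (hm : m ≠ 0) (hT : IsPositive T) (hs : HasSupport T) :
    (adjoint T 1).PosDef := by
  have hpsd := posSemidef_adjoint_one hT
  rw [hpsd.1.posDef_iff_eigenvalues_pos]
  intro i
  obtain ⟨σ, hσ⟩ := (hasSupport_iff hT).mp hs hpsd.1.eigenvectorBasis
    (EuclideanSpace.basisFun (Fin m) ℂ)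
  have h : (adjoint T 1 * proj (hpsd.1.eigenvectorBasis i)).trace.re =
      ∑ j, overlap T (hpsd.1.eigenvectorBasis i) (EuclideanSpace.basisFun (Fin m) ℂ j) := by
    rw [sum_overlap_right, trace_map_eq_trace_mul_adjoint_one, hpsd.1.eq, Matrix.trace_mul_comm]
  rw [← trace_mul_proj_eigenvectorBasis, h]
  exact Finset.sum_pos' (fun j _ => overlap_nonneg hT _ _)
    ⟨_, Finset.mem_univ _, hσ (i, ⟨0, Nat.pos_of_ne_zero hm⟩)⟩

/-- On the matrices of determinant one, `det T(X)` is coercive. -/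
theorem HasSupport.exists_eigenvalues_le [NeZero k] [NeZero m] (hkm : Nat.Coprime k m)
    (hT : IsPositive T) (hs : HasSupport T) (B : ℝ) :
    ∃ R : ℝ, ∀ (X : Matrix (Fin k) (Fin k) ℂ) (hX : X.PosDef), X.det.re = 1 →
      (T X).det.re ≤ B → ∀ i, hX.1.eigenvalues i ≤ R := by
  obtain ⟨δ, hδ, hu⟩ := hs.exists_uniform hT
  set e := max 0 (-Real.log δ) with he
  -- Shifting each difference of logarithms by `e` makes it nonnegative; `K` is the bound on the
  -- total of the shifted terms, plus `e` to cover the lower side.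
  set K := max 0 (k * Real.log B) + (k * m : ℕ) * e + e with hK
  refine ⟨Real.exp (2 * k * K), fun X hX hdet hB i => ?_⟩
  have hY := hs.posDef_map (NeZero.ne k) hT hX
  obtain ⟨σ, hσ⟩ := hu hX.1.eigenvectorBasis hY.1.eigenvectorBasis
  have hl := hX.eigenvalues_pos
  have hmu := hY.eigenvalues_pos
  have hlow : ∀ x : Fin k × Fin m, 0 ≤
      Real.log (hY.1.eigenvalues (σ x).1) - Real.log (hX.1.eigenvalues x.1) + e := by
    intro x
    have h1 : hX.1.eigenvalues x.1 * δ ≤ hY.1.eigenvalues (σ x).1 := by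
      rw [← trace_mul_proj_eigenvectorBasis hY.1, trace_map_mul_proj hX.1]
      refine (mul_le_mul_of_nonneg_left (hσ x) (hl _).le).trans ?_
      exact Finset.single_le_sum (f := fun i => hX.1.eigenvalues i *
        overlap T (hX.1.eigenvectorBasis i) (hY.1.eigenvectorBasis (σ x).1))
        (fun i _ => mul_nonneg (hl i).le (overlap_nonneg hT _ _)) (Finset.mem_univ x.1)
    have h2 := Real.log_le_log (mul_pos (hl _) hδ) h1
    rw [Real.log_mul (hl _).ne' hδ.ne'] at h2
    linarith [le_max_right 0 (-Real.log δ)]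
  have hsumX : ∑ i, Real.log (hX.1.eigenvalues i) = 0 := by
    rw [← Real.log_prod fun i _ => (hl i).ne', ← re_det_eq_prod_eigenvalues, hdet, Real.log_one]
  have hsumY : ∑ j, Real.log (hY.1.eigenvalues j) ≤ Real.log B := by
    rw [← Real.log_prod fun i _ => (hmu i).ne', ← re_det_eq_prod_eigenvalues]
    refine Real.log_le_log ?_ hB
    rw [re_det_eq_prod_eigenvalues hY.1]
    exact Finset.prod_pos fun j _ => hmu j
  have htot : ∑ x : Fin k × Fin m,
      (Real.log (hY.1.eigenvalues (σ x).1) - Real.log (hX.1.eigenvalues x.1) + e) ≤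
      max 0 (k * Real.log B) + (k * m : ℕ) * e := by
    rw [Finset.sum_add_distrib, Finset.sum_sub_distrib,
      Equiv.sum_comp σ (fun y => Real.log (hY.1.eigenvalues y.1)), Fintype.sum_prod_type,
      Fintype.sum_prod_type]
    simp only [Finset.sum_const, Finset.card_univ, Fintype.card_fin, Fintype.card_prod,
      nsmul_eq_mul, ← Finset.mul_sum, hsumX, mul_zero, sub_zero]
    have := mul_le_mul_of_nonneg_left hsumY (Nat.cast_nonneg (α := ℝ) k)
    linarith [le_max_right 0 (k * Real.log B)]
  have he0 : 0 ≤ e := le_max_left _ _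
  have hb0 : 0 ≤ max 0 (k * Real.log B) := le_max_left _ _
  have hke : 0 ≤ (k * m : ℕ) * e := by positivity
  have habs : ∀ x : Fin k × Fin m,
      |Real.log (hY.1.eigenvalues (σ x).1) - Real.log (hX.1.eigenvalues x.1)| ≤ K := by
    intro x
    -- A nonnegative term is at most the total: the lower bounds along `σ` become upper bounds.
    have h1 := (Finset.single_le_sum (fun y _ => hlow y) (Finset.mem_univ x)).trans htot
    have h2 := hlow x
    exact abs_le.mpr ⟨by linarith, by linarith⟩
  -- The logarithms sum to zero, so one of them is nonpositive; the others exceed it by at most 2kK.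
  obtain ⟨i', -, hi'⟩ := Finset.exists_le_of_sum_le (s := (Finset.univ : Finset (Fin k)))
    (f := fun i => Real.log (hX.1.eigenvalues i)) (g := fun _ => 0)
    ⟨0, Finset.mem_univ _⟩ (by simp [hsumX])
  have h : Real.log (hX.1.eigenvalues i) - Real.log (hX.1.eigenvalues i') ≤ 2 * k * K :=
    sub_le_of_transport hkm σ (fun i => Real.log (hX.1.eigenvalues i))
    (fun j => Real.log (hY.1.eigenvalues j)) habs i' i
  rw [← Real.log_le_iff_le_exp (hl i)]
  linarith

/-! ### Existence of a minimiser -/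

theorem isClosed_setOf_posSemidef (n : ℕ) :
    IsClosed {X : Matrix (Fin n) (Fin n) ℂ | X.PosSemidef} := by
  have h : {X : Matrix (Fin n) (Fin n) ℂ | X.PosSemidef} =
      ⋂ x : Fin n → ℂ, {X | 0 ≤ star x ⬝ᵥ (X *ᵥ x)} := by
    ext X
    rw [Set.mem_iInter]
    exact ⟨fun h x => h.dotProduct_mulVec_nonneg x, posSemidef_of_dotProduct_mulVec_nonneg⟩
  rw [h]
  refine isClosed_iInter fun x => isClosed_le continuous_const ?_
  fun_prop

theorem norm_proj_apply_le {n : ℕ} (x : EuclideanSpace ℂ (Fin n)) (a b : Fin n) :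
    ‖proj x a b‖ ≤ ‖x‖ * ‖x‖ := by
  simp only [proj, Matrix.vecMulVec_apply, norm_mul, Pi.star_apply, norm_star]
  exact mul_le_mul (PiLp.norm_apply_le x a) (PiLp.norm_apply_le x b) (norm_nonneg _)
    (norm_nonneg _)

theorem norm_apply_le_of_eigenvalues_le {n : ℕ} {X : Matrix (Fin n) (Fin n) ℂ}
    (hX : X.PosSemidef) {R : ℝ} (hR : ∀ i, hX.1.eigenvalues i ≤ R) (a b : Fin n) :
    ‖X a b‖ ≤ n * R := by
  conv_lhs => rw [eq_sum_eigenvalues_smul_proj hX.1, Matrix.sum_apply]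
  refine (norm_sum_le _ _).trans ?_
  have h : ∀ i ∈ (Finset.univ : Finset (Fin n)),
      ‖((hX.1.eigenvalues i : ℂ) • proj (hX.1.eigenvectorBasis i)) a b‖ ≤ R := by
    intro i _
    have h1 := norm_proj_apply_le (hX.1.eigenvectorBasis i) a b
    rw [hX.1.eigenvectorBasis.orthonormal.1 i, mul_one] at h1
    rw [Matrix.smul_apply, smul_eq_mul, norm_mul, Complex.norm_real,
      Real.norm_of_nonneg (hX.eigenvalues_nonneg i)]
    calc _ ≤ hX.1.eigenvalues i * 1 := mul_le_mul_of_nonneg_left h1 (hX.eigenvalues_nonneg i)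
      _ ≤ R := by simpa using hR i
  simpa using Finset.sum_le_card_nsmul _ _ _ h

theorem det_coe_re {n : ℕ} {X : Matrix (Fin n) (Fin n) ℂ} (hX : X.PosSemidef) :
    (X.det.re : ℂ) = X.det :=
  Complex.ext rfl (by simpa using (Complex.nonneg_iff.mp hX.det_nonneg).2)

theorem re_det_pos {n : ℕ} {X : Matrix (Fin n) (Fin n) ℂ} (hX : X.PosDef) : 0 < X.det.re :=
  (Complex.pos_iff.mp hX.det_pos).1

/-- Under support and coprimality, `det T(X)` attains its minimum among the positive definite
matrices of determinant one. -/
theorem HasSupport.exists_isMinOn_det [NeZero k] [NeZero m] (hkm : Nat.Coprime k m)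
    (hT : IsPositive T) (hs : HasSupport T) :
    ∃ Z : Matrix (Fin k) (Fin k) ℂ, Z.PosDef ∧ Z.det = 1 ∧
      ∀ X : Matrix (Fin k) (Fin k) ℂ, X.PosDef → X.det = 1 → (T Z).det.re ≤ (T X).det.re := by
  obtain ⟨R, hR⟩ := hs.exists_eigenvalues_le hkm hT (T 1).det.re
  -- The 1 keeps the identity inside the compact set `C`; competitors outside `C` have det T(X) no
  -- smaller than det T(1).
  set r : ℝ := max (k * R) 1 with hr
  set C : Set (Matrix (Fin k) (Fin k) ℂ) :=
    {X | X.PosSemidef} ∩ ({X | X.det = 1} ∩ {X | ∀ a b, ‖X a b‖ ≤ r}) with hC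
  have hclosed : IsClosed C := by
    refine (isClosed_setOf_posSemidef k).inter (IsClosed.inter ?_ ?_)
    · exact isClosed_eq (Continuous.matrix_det continuous_id) continuous_const
    · simp only [Set.ofPred_forall]
      refine isClosed_iInter fun a => isClosed_iInter fun b => isClosed_le ?_ continuous_const
      exact (continuous_id.matrix_elem a b).norm
  have hcompact : IsCompact C := by
    refine IsCompact.of_isClosed_subset (isCompact_univ_pi fun _ : Fin k =>
      isCompact_univ_pi fun _ : Fin k => isCompact_closedBall (0 : ℂ) r) hclosed ?_
    intro X hX a _ b _
    simpa using hX.2.2 a b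
  have h1 : (1 : Matrix (Fin k) (Fin k) ℂ) ∈ C := by
    refine ⟨Matrix.PosSemidef.one, Matrix.det_one, fun a b => ?_⟩
    rw [Matrix.one_apply]
    split_ifs <;> simp [hr]
  have hcont : Continuous fun X => (T X).det.re :=
    Complex.continuous_re.comp (Continuous.matrix_det T.continuous_of_finiteDimensional)
  obtain ⟨Z, hZ, hmin⟩ := hcompact.exists_isMinOn ⟨1, h1⟩ hcont.continuousOn
  refine ⟨Z, ?_, hZ.2.1, fun X hX hdet => ?_⟩
  · rw [hZ.1.posDef_iff_det_ne_zero, hZ.2.1]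
    exact one_ne_zero
  · rcases le_total (T X).det.re (T 1).det.re with h | h
    · refine hmin ⟨hX.posSemidef, hdet, fun a b => ?_⟩
      exact (norm_apply_le_of_eigenvalues_le hX.posSemidef (hR X hX (by simp [hdet]) h) a b).trans
        (le_max_left _ _)
    · exact (hmin h1).trans h

/-- The scale-invariant form of the minimality. -/
theorem HasSupport.exists_minimizer [NeZero k] [NeZero m] (hkm : Nat.Coprime k m)
    (hT : IsPositive T) (hs : HasSupport T) :
    ∃ Z : Matrix (Fin k) (Fin k) ℂ, Z.PosDef ∧
      ∀ X : Matrix (Fin k) (Fin k) ℂ, X.PosDef →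
        (T Z).det.re ^ k * X.det.re ^ m ≤ (T X).det.re ^ k * Z.det.re ^ m := by
  obtain ⟨Z, hZ, hZ1, hmin⟩ := hs.exists_isMinOn_det hkm hT
  refine ⟨Z, hZ, fun X hX => ?_⟩
  have hd := re_det_pos hX
  -- The factor for which det(cX) = 1.
  set c : ℝ := X.det.re ^ (-(1 : ℝ) / k) with hc
  have hcpos : 0 < c := Real.rpow_pos_of_pos hd _
  have hk : (k : ℝ) ≠ 0 := NeZero.ne _
  have hck : c ^ k * X.det.re = 1 := by
    rw [hc, ← Real.rpow_natCast, ← Real.rpow_mul hd.le, div_mul_cancel₀ _ hk, Real.rpow_neg_one,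
      inv_mul_cancel₀ hd.ne']
  have hcX : ((c : ℂ) • X).PosDef := hX.smul (by exact_mod_cast hcpos)
  have h := hmin _ hcX (by
    rw [Matrix.det_smul, Fintype.card_fin, ← det_coe_re hX.posSemidef]
    exact_mod_cast hck)
  rw [map_smul, Matrix.det_smul, Fintype.card_fin, ← Complex.ofReal_pow,
    Complex.re_ofReal_mul] at h
  have hTZ := re_det_pos (hs.posDef_map (NeZero.ne k) hT hZ)
  have hpow := pow_le_pow_left₀ hTZ.le h k
  rw [mul_pow, ← pow_mul, mul_comm m k, pow_mul] at hpow
  calc (T Z).det.re ^ k * X.det.re ^ m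
      ≤ ((c ^ k) ^ m * (T X).det.re ^ k) * X.det.re ^ m := by gcongr
    _ = (c ^ k * X.det.re) ^ m * (T X).det.re ^ k := by rw [mul_pow]; ring
    _ = (T X).det.re ^ k * Z.det.re ^ m := by rw [hck, hZ1]; simp

/-! ### First-order condition and scaling -/

/-- `X ↦ B T(A X A*) B*`. -/
noncomputable def congruence (T : Matrix (Fin k) (Fin k) ℂ →ₗ[ℂ] Matrix (Fin m) (Fin m) ℂ)
    (A : Matrix (Fin k) (Fin k) ℂ) (B : Matrix (Fin m) (Fin m) ℂ) :
    Matrix (Fin k) (Fin k) ℂ →ₗ[ℂ] Matrix (Fin m) (Fin m) ℂ :=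
  LinearMap.mulRight ℂ Bᴴ ∘ₗ LinearMap.mulLeft ℂ B ∘ₗ T ∘ₗ LinearMap.mulRight ℂ Aᴴ ∘ₗ
    LinearMap.mulLeft ℂ A

@[simp]
theorem congruence_apply (A : Matrix (Fin k) (Fin k) ℂ) (B : Matrix (Fin m) (Fin m) ℂ)
    (X : Matrix (Fin k) (Fin k) ℂ) :
    congruence T A B X = B * T (A * X * Aᴴ) * Bᴴ := rfl

theorem IsPositive.congruence (hT : IsPositive T) (A : Matrix (Fin k) (Fin k) ℂ)
    (B : Matrix (Fin m) (Fin m) ℂ) : IsPositive (congruence T A B) := fun _ hX =>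
  (hT _ (hX.mul_mul_conjTranspose_same A)).mul_mul_conjTranspose_same B

open scoped MatrixOrder Matrix.Norms.L2Operator in
theorem exists_isUnit_eq_mul_conjTranspose {n : ℕ} {X : Matrix (Fin n) (Fin n) ℂ}
    (hX : X.PosDef) : ∃ A : Matrix (Fin n) (Fin n) ℂ, IsUnit A ∧ X = A * Aᴴ := by
  obtain ⟨A, hA, hX'⟩ :=
    CStarAlgebra.isStrictlyPositive_iff_eq_mul_star_self.mp hX.isStrictlyPositive
  exact ⟨A, hA, hX'⟩

theorem hasDerivAt_re_det_one_add_smul {n : ℕ} (A : Matrix (Fin n) (Fin n) ℂ) :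
    HasDerivAt (fun t : ℝ => (1 + (t : ℂ) • A).det.re) A.trace.re 0 := by
  have h : HasDerivAt (fun z : ℂ => (1 + z • A).det) A.trace ((0 : ℝ) : ℂ) := by
    set p := (Matrix.det (1 + (Polynomial.X : Polynomial ℂ) • A.map Polynomial.C)).divX.divX
    have h0 : (fun z : ℂ => (1 + z • A).det) =
        fun z => 1 + A.trace * z + p.eval z * z ^ 2 :=
      funext fun z => Matrix.det_one_add_smul z A
    rw [h0, Complex.ofReal_zero]
    have h1 := (((hasDerivAt_id (0 : ℂ)).const_mul A.trace).const_add 1).add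
      ((p.hasDerivAt 0).mul ((hasDerivAt_id (0 : ℂ)).pow 2))
    exact h1.congr_deriv (by simp)
  exact h.real_of_complex

theorem nonneg_of_hasDerivAt {f : ℝ → ℝ} {f' : ℝ} (hf : HasDerivAt f f' 0) (h0 : f 0 = 0)
    (h : ∀ t, 0 < t → 0 ≤ f t) : 0 ≤ f' := by
  have h1 := (hasDerivAt_iff_tendsto_slope_zero.mp hf).mono_left
    (nhdsWithin_mono 0 (fun t (ht : 0 < t) => ht.ne') : nhdsWithin (0 : ℝ) (Set.Ioi 0) ≤ _)
  refine ge_of_tendsto h1 ?_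
  filter_upwards [self_mem_nhdsWithin] with t ht
  have ht : 0 < t := ht
  simp only [zero_add, h0, sub_zero, smul_eq_mul]
  exact mul_nonneg (inv_nonneg.mpr ht.le) (h t ht)

/-- A unital positive map minimizing the capacity functional at the identity has scalar adjoint
image of the identity. -/
theorem adjoint_one_of_det_le (hk : k ≠ 0) (hT : IsPositive T) (h1 : T 1 = 1)
    (h : ∀ X : Matrix (Fin k) (Fin k) ℂ, X.PosDef → X.det.re ^ m ≤ (T X).det.re ^ k) :
    adjoint T 1 = ((m : ℂ) / k) • 1 := by
  have key : ∀ X : Matrix (Fin k) (Fin k) ℂ, X.PosSemidef →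
      m * X.trace.re ≤ k * (T X).trace.re := by
    intro X hX
    -- For t > 0, det(1 + tT(X))^k - det(1 + tX)^m is nonnegative, and it vanishes at t = 0, so its
    -- derivative k tr T(X) - m tr X there is nonnegative.
    have hd := ((hasDerivAt_re_det_one_add_smul (T X)).pow k).sub
      ((hasDerivAt_re_det_one_add_smul X).pow m)
    have := nonneg_of_hasDerivAt hd (by simp) fun t ht => by
      have hp : (1 + (t : ℂ) • X).PosDef :=
        Matrix.PosDef.one.add_posSemidef (hX.smul (by exact_mod_cast ht.le))
      have := h _ hp
      rw [map_add, h1, map_smul] at this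
      simpa using this
    simpa using this
  have hk' : (k : ℝ) ≠ 0 := Nat.cast_ne_zero.mpr hk
  have hadj := posSemidef_adjoint_one hT
  set D := adjoint T 1 - ((m : ℂ) / k) • (1 : Matrix (Fin k) (Fin k) ℂ) with hD
  have htr : ∀ X : Matrix (Fin k) (Fin k) ℂ,
      (D * X).trace = (T X).trace - (m / k) * X.trace := by
    intro X
    rw [trace_map_eq_trace_mul_adjoint_one, hadj.1.eq, Matrix.trace_mul_comm X, hD, sub_mul,
      Matrix.trace_sub, smul_mul_assoc, one_mul, Matrix.trace_smul, smul_eq_mul]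
  have hpsd : D.PosSemidef := by
    refine posSemidef_of_dotProduct_mulVec_nonneg fun x => ?_
    have hp := posSemidef_proj (WithLp.toLp 2 x)
    rw [← trace_mul_proj _ (WithLp.toLp 2 x), htr, sub_nonneg]
    have h2 := key _ hp
    have ha := Complex.nonneg_iff.mp hp.trace_nonneg
    have hb := Complex.nonneg_iff.mp (hT _ hp).trace_nonneg
    rw [Complex.le_def]
    have hcast : (m : ℂ) / k = ((m / k : ℝ) : ℂ) := by push_cast; rfl
    rw [hcast, Complex.re_ofReal_mul, Complex.im_ofReal_mul, ← ha.2, ← hb.2]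
    refine ⟨?_, by simp⟩
    rw [div_mul_eq_mul_div, div_le_iff₀ (by positivity)]
    linarith
  -- Since T is unital, tr D = tr T(1) - (m/k) tr 1 = 0, and a positive semidefinite matrix of trace
  -- zero vanishes.
  have hz : D.trace = 0 := by
    have := htr 1
    rw [mul_one, h1, Matrix.trace_one, Matrix.trace_one, Fintype.card_fin, Fintype.card_fin,
      div_mul_cancel₀ _ (by exact_mod_cast hk), sub_self] at this
    exact this
  exact sub_eq_zero.mp (hpsd.trace_eq_zero_iff.mp hz)

/-- Operator Sinkhorn scaling in the coprime case. -/
theorem HasSupport.exists_isDoublyStochastic [NeZero k] [NeZero m] (hkm : Nat.Coprime k m)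
    (hT : IsPositive T) (hs : HasSupport T) :
    ∃ S : Matrix (Fin k) (Fin k) ℂ →ₗ[ℂ] Matrix (Fin m) (Fin m) ℂ,
      IsDoublyStochastic S ∧ Equivalent T S := by
  obtain ⟨Z, hZ, hmin⟩ := hs.exists_minimizer hkm hT
  have hTZ := hs.posDef_map (NeZero.ne k) hT hZ
  obtain ⟨A, hA, hAZ⟩ := exists_isUnit_eq_mul_conjTranspose hZ
  obtain ⟨B, hB, hBZ⟩ := exists_isUnit_eq_mul_conjTranspose hTZ
  have hBinv : B⁻¹ * B = 1 := Matrix.nonsing_inv_mul _ ((Matrix.isUnit_iff_isUnit_det _).mp hB)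
  set S₁ := congruence T A B⁻¹ with hS₁
  have hpos₁ : IsPositive S₁ := hT.congruence _ _
  have hone : S₁ 1 = 1 := by
    rw [hS₁, congruence_apply, mul_one, ← hAZ, hBZ, ← mul_assoc, hBinv, one_mul,
      ← Matrix.conjTranspose_mul, hBinv, Matrix.conjTranspose_one]
  have hdet : ∀ X : Matrix (Fin k) (Fin k) ℂ, X.PosDef → X.det.re ^ m ≤ (S₁ X).det.re ^ k := by
    intro X hX
    have hAX : (A * X * Aᴴ).PosDef :=
      (Matrix.IsUnit.posDef_star_right_conjugate_iff hA).mpr hX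
    have h := hmin _ hAX
    have hdX : (A * X * Aᴴ).det.re = X.det.re * Z.det.re := by
      have : (A * X * Aᴴ).det = X.det * Z.det := by
        rw [hAZ]; simp only [Matrix.det_mul]; ring
      rw [this, ← det_coe_re hX.posSemidef, Complex.re_ofReal_mul, Complex.ofReal_re]
    have hdT : (T (A * X * Aᴴ)).det.re = (S₁ X).det.re * (T Z).det.re := by
      have : (T (A * X * Aᴴ)).det = (S₁ X).det * (T Z).det := by
        have hdB : B⁻¹.det * B.det = 1 := by rw [← Matrix.det_mul, hBinv, Matrix.det_one]
        have hdB' : B⁻¹ᴴ.det * Bᴴ.det = 1 := by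
          rw [← Matrix.det_mul, ← Matrix.conjTranspose_mul, mul_eq_one_comm.mp hBinv,
            Matrix.conjTranspose_one, Matrix.det_one]
        rw [hBZ, hS₁, congruence_apply]
        simp only [Matrix.det_mul]
        linear_combination (-(T (A * X * Aᴴ)).det) * hdB' -
          (T (A * X * Aᴴ)).det * (B⁻¹ᴴ.det * Bᴴ.det) * hdB
      rw [this, ← det_coe_re (hpos₁ X hX.posSemidef), Complex.re_ofReal_mul, Complex.ofReal_re]
    rw [hdX, hdT, mul_pow, mul_pow] at h
    have hp : 0 < (T Z).det.re ^ k * Z.det.re ^ m :=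
      mul_pos (pow_pos (re_det_pos hTZ) _) (pow_pos (re_det_pos hZ) _)
    refine le_of_mul_le_mul_right ?_ hp
    linarith
  have hadj := adjoint_one_of_det_le (NeZero.ne k) hpos₁ hone hdet
  have htr : ∀ X, (S₁ X).trace = m / k * X.trace := by
    intro X
    rw [trace_map_eq_trace_mul_adjoint_one, hadj]
    simp
  have hk0 : 0 < Real.sqrt k := Real.sqrt_pos.mpr (Nat.cast_pos.mpr (NeZero.pos k))
  have hm0 : 0 < Real.sqrt m := Real.sqrt_pos.mpr (Nat.cast_pos.mpr (NeZero.pos m))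
  have hkk : ((Real.sqrt k : ℝ) : ℂ) * (Real.sqrt k : ℝ) = k := by
    exact_mod_cast Real.mul_self_sqrt (Nat.cast_nonneg k)
  have hmm : ((Real.sqrt m : ℝ) : ℂ) * (Real.sqrt m : ℝ) = m := by
    exact_mod_cast Real.mul_self_sqrt (Nat.cast_nonneg m)
  have hkC : ((Real.sqrt k : ℝ) : ℂ) ≠ 0 := by exact_mod_cast hk0.ne'
  have hmC : ((Real.sqrt m : ℝ) : ℂ) ≠ 0 := by exact_mod_cast hm0.ne'
  -- The unital map must be multiplied by √k/√m; the left factor `d • B⁻¹` enters twice, hence the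
  -- square root.
  set d : ℝ := Real.sqrt (Real.sqrt k / Real.sqrt m) with hd
  have hdd : (d : ℂ) * d = (Real.sqrt k : ℝ) / (Real.sqrt m : ℝ) := by
    exact_mod_cast Real.mul_self_sqrt (div_nonneg hk0.le hm0.le)
  have hd0 : (d : ℂ) ≠ 0 := by
    exact_mod_cast (Real.sqrt_pos.mpr (div_pos hk0 hm0)).ne'
  have hS : ∀ X, congruence T A ((d : ℂ) • B⁻¹) X =
      (((Real.sqrt k : ℝ) : ℂ) / (Real.sqrt m : ℝ)) • S₁ X := by
    intro X
    rw [← hdd, hS₁, congruence_apply, congruence_apply]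
    simp only [Matrix.conjTranspose_smul, Matrix.smul_mul, Matrix.mul_smul, smul_smul,
      Complex.star_def, Complex.conj_ofReal]
  refine ⟨congruence T A ((d : ℂ) • B⁻¹), ⟨hT.congruence _ _, ?_, ?_⟩,
    A, (d : ℂ) • B⁻¹, hA, ?_, fun X => rfl⟩
  · rw [hS, map_smul, hone, smul_smul]
    congr 1
    field_simp
  · refine (eq_adjoint _ _ _ fun X => ?_).symm
    rw [hS]
    simp only [Matrix.conjTranspose_smul, Matrix.conjTranspose_one, Matrix.mul_smul,
      mul_one, Matrix.trace_smul, htr, smul_eq_mul, star_inv₀,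
      Complex.star_def, Complex.conj_ofReal]
    rw [← hkk, ← hmm]
    field_simp
  · rw [Matrix.isUnit_iff_isUnit_det, Matrix.det_smul]
    refine IsUnit.mul (IsUnit.pow _ (isUnit_iff_ne_zero.mpr hd0)) ?_
    exact (Matrix.isUnit_iff_isUnit_det _).mp (IsUnit.of_mul_eq_one _ hBinv)

/-! ### From doubly stochastic to support -/

variable {S : Matrix (Fin k) (Fin k) ℂ →ₗ[ℂ] Matrix (Fin m) (Fin m) ℂ}

theorem trace_proj_of_norm_eq_one {n : ℕ} {x : EuclideanSpace ℂ (Fin n)} (hx : ‖x‖ = 1) :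
    (proj x).trace = 1 := by
  have h := inner_self_eq_norm_sq_to_K (𝕜 := ℂ) x
  rw [hx, EuclideanSpace.inner_eq_star_dotProduct] at h
  rw [proj, Matrix.trace_vecMulVec]
  simpa using h

/-- If one size is 0, coprimality makes the other 1; the identity of order 0 is zero, but its image
would have to be the nonzero 1 × 1 identity. -/
theorem IsDoublyStochastic.ne_zero (hkm : Nat.Coprime k m) (hS : IsDoublyStochastic S) :
    k ≠ 0 ∧ m ≠ 0 := by
  obtain ⟨-, h1, h2⟩ := hS
  constructor
  · rintro rfl
    obtain rfl : m = 1 := by simpa using hkm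
    rw [Subsingleton.elim ((((Real.sqrt (0 : ℕ) : ℝ) : ℂ)⁻¹ • 1 : Matrix (Fin 0) (Fin 0) ℂ)) 0,
      map_zero] at h1
    simpa using congrFun (congrFun h1 0) 0
  · rintro rfl
    obtain rfl : k = 1 := by simpa using hkm
    rw [Subsingleton.elim ((((Real.sqrt (0 : ℕ) : ℝ) : ℂ)⁻¹ • 1 : Matrix (Fin 0) (Fin 0) ℂ)) 0,
      map_zero] at h2
    simpa using congrFun (congrFun h2 0) 0

theorem IsDoublyStochastic.sqrt_mul_sum_right (hk : k ≠ 0) (hm : m ≠ 0) (hS : IsDoublyStochastic S)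
    {x : EuclideanSpace ℂ (Fin k)} (hx : ‖x‖ = 1)
    (w : OrthonormalBasis (Fin m) ℂ (EuclideanSpace ℂ (Fin m))) :
    Real.sqrt k * ∑ j, overlap S x (w j) = Real.sqrt m := by
  have hk0 : Real.sqrt k ≠ 0 := by simpa using hk
  have hm0 : Real.sqrt m ≠ 0 := by simpa using hm
  have h := trace_adjoint S (proj x) ((((Real.sqrt m : ℝ) : ℂ))⁻¹ • 1)
  rw [hS.2.2] at h
  simp only [Matrix.conjTranspose_smul, Matrix.conjTranspose_one, Matrix.mul_smul, mul_one,
    Matrix.trace_smul, trace_proj_of_norm_eq_one hx, smul_eq_mul, Complex.star_def,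
    Complex.conj_ofReal, ← Complex.ofReal_inv] at h
  have h' := congrArg Complex.re h
  rw [Complex.re_ofReal_mul, Complex.ofReal_re] at h'
  rw [sum_overlap_right]
  field_simp at h'
  linarith

theorem IsDoublyStochastic.sqrt_mul_sum_left (hk : k ≠ 0) (hm : m ≠ 0) (hS : IsDoublyStochastic S)
    (v : OrthonormalBasis (Fin k) ℂ (EuclideanSpace ℂ (Fin k)))
    {y : EuclideanSpace ℂ (Fin m)} (hy : ‖y‖ = 1) :
    Real.sqrt m * ∑ i, overlap S (v i) y = Real.sqrt k := by
  have hk0 : Real.sqrt k ≠ 0 := by simpa using hk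
  have hm0 : Real.sqrt m ≠ 0 := by simpa using hm
  have h := congrArg (fun M => (M * proj y).trace) hS.2.1
  simp only [map_smul, Matrix.smul_mul, one_mul, Matrix.trace_smul,
    trace_proj_of_norm_eq_one hy, smul_eq_mul, mul_one, ← Complex.ofReal_inv] at h
  have h' := congrArg Complex.re h
  rw [Complex.re_ofReal_mul, Complex.ofReal_re] at h'
  rw [sum_overlap_left]
  field_simp at h'
  linarith

/-- A vanishing block of a doubly stochastic map satisfies Hall's inequality. -/
theorem IsDoublyStochastic.rank_add_rank_le (hk : k ≠ 0) (hm : m ≠ 0) (hS : IsDoublyStochastic S)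
    {P : Matrix (Fin k) (Fin k) ℂ} {Q : Matrix (Fin m) (Fin m) ℂ} (hP : P.PosSemidef)
    (hQ : Q.PosSemidef) (h : (S P * Q).trace = 0) : m * P.rank + k * Q.rank ≤ k * m := by
  classical
  set I := Finset.univ.filter fun i => hP.1.eigenvalues i ≠ 0 with hI
  set J := Finset.univ.filter fun j => hQ.1.eigenvalues j ≠ 0 with hJ
  have hcI : P.rank = I.card := by rw [hP.1.rank_eq_card_non_zero_eigs, Fintype.card_subtype]
  have hcJ : Q.rank = J.card := by rw [hQ.1.rank_eq_card_non_zero_eigs, Fintype.card_subtype]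
  set o : Fin k → Fin m → ℝ := fun i j =>
    overlap S (hP.1.eigenvectorBasis i) (hQ.1.eigenvectorBasis j) with ho
  have ho0 : ∀ i j, 0 ≤ o i j := fun i j => overlap_nonneg hS.1 _ _
  have hzero : ∀ i ∈ I, ∀ j ∈ J, o i j = 0 := by
    intro i hi j hj
    have h1 := trace_map_mul (T := S) hP.1 hQ.1
    have hnn : ∀ j i, 0 ≤ hP.1.eigenvalues i * hQ.1.eigenvalues j * o i j := fun j i =>
      mul_nonneg (mul_nonneg (hP.eigenvalues_nonneg i) (hQ.eigenvalues_nonneg j)) (ho0 i j)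
    rw [h, Complex.zero_re, eq_comm, Finset.sum_eq_zero_iff_of_nonneg
      fun j _ => Finset.sum_nonneg fun i _ => hnn j i] at h1
    have h2 := h1 j (Finset.mem_univ j)
    rw [Finset.sum_eq_zero_iff_of_nonneg fun i _ => hnn j i] at h2
    have h3 := h2 i (Finset.mem_univ i)
    exact (mul_eq_zero.mp h3).resolve_left
      (mul_ne_zero (Finset.mem_filter.mp hi).2 (Finset.mem_filter.mp hj).2)
  have hrow : ∀ i, Real.sqrt k * ∑ j, o i j = Real.sqrt m := fun i =>
    hS.sqrt_mul_sum_right hk hm (hP.1.eigenvectorBasis.orthonormal.1 i) _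
  have hcol : ∀ j, Real.sqrt m * ∑ i, o i j = Real.sqrt k := fun j =>
    hS.sqrt_mul_sum_left hk hm _ (hQ.1.eigenvectorBasis.orthonormal.1 j)
  -- The whole mass of the rows `I` lies in the columns outside `J`.
  have hsum : ∑ i ∈ I, ∑ j, o i j ≤ ∑ j ∈ Jᶜ, ∑ i, o i j := by
    rw [Finset.sum_comm,
      ← Finset.sum_add_sum_compl J]
    have : ∑ j ∈ J, ∑ i ∈ I, o i j = 0 :=
      Finset.sum_eq_zero fun j hj => Finset.sum_eq_zero fun i hi => hzero i hi j hj
    rw [this, zero_add]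
    exact Finset.sum_le_sum fun j _ =>
      Finset.sum_le_sum_of_subset_of_nonneg (Finset.subset_univ _) fun i _ _ => ho0 i j
  have hkk : Real.sqrt k * Real.sqrt k = k := Real.mul_self_sqrt (Nat.cast_nonneg k)
  have hmm : Real.sqrt m * Real.sqrt m = m := Real.mul_self_sqrt (Nat.cast_nonneg m)
  have h1 : Real.sqrt k * ∑ i ∈ I, ∑ j, o i j = I.card * Real.sqrt m := by
    rw [Finset.mul_sum, Finset.sum_congr rfl fun i _ => hrow i, Finset.sum_const, nsmul_eq_mul]
  have h2 : Real.sqrt m * ∑ j ∈ Jᶜ, ∑ i, o i j = Jᶜ.card * Real.sqrt k := by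
    rw [Finset.mul_sum, Finset.sum_congr rfl fun j _ => hcol j, Finset.sum_const, nsmul_eq_mul]
  have h3 : (m * I.card : ℝ) ≤ k * Jᶜ.card := by
    calc (m * I.card : ℝ) = Real.sqrt m * (Real.sqrt k * ∑ i ∈ I, ∑ j, o i j) := by
          rw [h1]; linear_combination -(I.card : ℝ) * hmm
      _ = Real.sqrt m * Real.sqrt k * ∑ i ∈ I, ∑ j, o i j := by ring
      _ ≤ Real.sqrt m * Real.sqrt k * ∑ j ∈ Jᶜ, ∑ i, o i j := by gcongr
      _ = Real.sqrt k * (Real.sqrt m * ∑ j ∈ Jᶜ, ∑ i, o i j) := by ring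
      _ = k * Jᶜ.card := by rw [h2]; linear_combination (Jᶜ.card : ℝ) * hkk
  have h4 : m * I.card ≤ k * Jᶜ.card := by exact_mod_cast h3
  have h5 : Jᶜ.card + J.card = m := by simp
  rw [hcI, hcJ]
  calc _ ≤ k * Jᶜ.card + k * J.card := by omega
    _ = k * m := by rw [← mul_add, h5]

/-- Hall's condition for `T` is the rank inequality for `S`, applied to projections transported by
the inverse congruences. -/
theorem Equivalent.hasSupport (hk : k ≠ 0) (hm : m ≠ 0) (hT : IsPositive T)
    (hS : IsDoublyStochastic S) (h : Equivalent T S) : HasSupport T := by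
  classical
  obtain ⟨A, B, hA, hB, hTS⟩ := h
  have hdA := (Matrix.isUnit_iff_isUnit_det _).mp hA
  have hdB := (Matrix.isUnit_iff_isUnit_det _).mp hB
  have hdA' : IsUnit A⁻¹.det := by simpa using hdA
  have hdB' : IsUnit B⁻¹.det := by simpa using hdB
  rw [hasSupport_iff hT]
  intro v w
  have hblock : ∀ (I : Finset (Fin k)) (J : Finset (Fin m)),
      (∀ i ∈ I, ∀ j ∈ J, overlap T (v i) (w j) = 0) → m * I.card + k * J.card ≤ k * m := by
    intro I J hIJ
    have hP : (∑ i ∈ I, proj (v i)).PosSemidef :=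
      Matrix.posSemidef_sum _ fun i _ => posSemidef_proj _
    have hQ : (∑ j ∈ J, proj (w j)).PosSemidef :=
      Matrix.posSemidef_sum _ fun j _ => posSemidef_proj _
    have hz : (T (∑ i ∈ I, proj (v i)) * ∑ j ∈ J, proj (w j)).trace = 0 := by
      simp only [map_sum, Finset.sum_mul, Finset.mul_sum, Matrix.trace_sum]
      exact Finset.sum_eq_zero fun j hj => Finset.sum_eq_zero fun i hi => by
        rw [← coe_overlap hT, hIJ i hi j hj, Complex.ofReal_zero]
    have hr := hS.rank_add_rank_le hk hm (hP.mul_mul_conjTranspose_same A⁻¹)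
      (hQ.conjTranspose_mul_mul_same B⁻¹) (by
        rw [hTS]
        have hAA : A * (A⁻¹ * (∑ i ∈ I, proj (v i)) * A⁻¹ᴴ) * Aᴴ = ∑ i ∈ I, proj (v i) := by
          have h1 : A * A⁻¹ = 1 := Matrix.mul_nonsing_inv _ hdA
          have h2 : A⁻¹ᴴ * Aᴴ = 1 := by
            rw [← Matrix.conjTranspose_mul, h1, Matrix.conjTranspose_one]
          calc _ = (A * A⁻¹) * (∑ i ∈ I, proj (v i)) * (A⁻¹ᴴ * Aᴴ) := by
                simp only [mul_assoc]
            _ = _ := by rw [h1, h2, one_mul, mul_one]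
        have h1 : B⁻¹ * B = 1 := Matrix.nonsing_inv_mul _ hdB
        have h2 : Bᴴ * B⁻¹ᴴ = 1 := by
          rw [← Matrix.conjTranspose_mul, h1, Matrix.conjTranspose_one]
        rw [hAA, ← hz]
        set M := T (∑ i ∈ I, proj (v i))
        set Q := ∑ j ∈ J, proj (w j)
        calc (B * M * Bᴴ * (B⁻¹ᴴ * Q * B⁻¹)).trace
            = (B * (M * (Bᴴ * B⁻¹ᴴ) * Q * B⁻¹)).trace := by simp only [mul_assoc]
          _ = (M * Q * B⁻¹ * B).trace := by rw [h2, mul_one, Matrix.trace_mul_comm]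
          _ = (M * Q).trace := by rw [mul_assoc, h1, mul_one])
    have hdet : ∀ {n : ℕ} {C : Matrix (Fin n) (Fin n) ℂ}, IsUnit C.det → IsUnit Cᴴ.det := by
      intro n C hC
      rw [Matrix.det_conjTranspose]
      exact hC.star
    rwa [Matrix.rank_mul_eq_left_of_isUnit_det _ _ (hdet hdA'),
      Matrix.rank_mul_eq_right_of_isUnit_det _ _ hdA',
      Matrix.rank_mul_eq_left_of_isUnit_det _ _ hdB',
      Matrix.rank_mul_eq_right_of_isUnit_det _ _ (hdet hdB'), rank_sum_proj, rank_sum_proj] at hr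
  set t : Fin k × Fin m → Finset (Fin m × Fin k) := fun x =>
    (Finset.univ.filter fun j => overlap T (v x.1) (w j) ≠ 0) ×ˢ Finset.univ with ht
  obtain ⟨f, hf, hf'⟩ := (Finset.all_card_le_biUnion_card_iff_exists_injective t).mp (by
    intro s
    -- `J` collects the columns not adjacent to `I`, so the neighbourhood of `s` has at least k(m -
    -- |J|) ≥ m|I| ≥ |s| elements.
    set I := s.image Prod.fst with hI
    set J := Finset.univ.filter fun j => ∀ i ∈ I, overlap T (v i) (w j) = 0 with hJ
    have h1 := hblock I J fun i hi j hj => (Finset.mem_filter.mp hj).2 i hi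
    have h2 : s.card ≤ m * I.card := by
      refine (Finset.card_le_card (t := I ×ˢ Finset.univ) fun x hx => ?_).trans ?_
      · exact Finset.mem_product.mpr ⟨Finset.mem_image_of_mem Prod.fst hx, Finset.mem_univ _⟩
      · simp [mul_comm]
    have h3 : Jᶜ ×ˢ (Finset.univ : Finset (Fin k)) ⊆ s.biUnion t := by
      rintro ⟨j, q⟩ hj
      obtain ⟨i, hi, hij⟩ : ∃ i ∈ I, overlap T (v i) (w j) ≠ 0 := by
        simpa [hJ] using hj
      obtain ⟨x, hx, rfl⟩ := Finset.mem_image.mp hi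
      exact Finset.mem_biUnion.mpr ⟨x, hx, by simpa [ht] using hij⟩
    have h4 := Finset.card_le_card h3
    rw [Finset.card_product, Finset.card_univ, Fintype.card_fin, mul_comm] at h4
    have h5 : Jᶜ.card + J.card = m := by simp
    have h6 : k * Jᶜ.card + k * J.card = k * m := by rw [← mul_add, h5]
    omega)
  have hbij : Function.Bijective f :=
    (Fintype.bijective_iff_injective_and_card f).mpr ⟨hf, by simp [mul_comm]⟩
  refine ⟨Equiv.ofBijective f hbij, fun x => (overlap_nonneg hT _ _).lt_of_ne' ?_⟩
  have := hf' x
  simp only [ht, Finset.mem_product, Finset.mem_filter, Finset.mem_univ, true_and, and_true] at this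
  exact this

end PosMap

theorem corollary3p10 {k m : ℕ} (hkm : Nat.Coprime k m)
    (T : Matrix (Fin k) (Fin k) ℂ →ₗ[ℂ] Matrix (Fin m) (Fin m) ℂ) (hT : PosMap.IsPositive T) :
    (∃ S : Matrix (Fin k) (Fin k) ℂ →ₗ[ℂ] Matrix (Fin m) (Fin m) ℂ,
        PosMap.IsDoublyStochastic S ∧ PosMap.Equivalent T S) ↔
      (PosMap.HasSupport T ∧ (T 1).PosDef ∧ (PosMap.adjoint T 1).PosDef) := by
  constructor
  · rintro ⟨S, hS, hTS⟩
    obtain ⟨hk, hm⟩ := hS.ne_zero hkm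
    have hs := hTS.hasSupport hk hm hT hS
    exact ⟨hs, hs.posDef_map hk hT Matrix.PosDef.one, hs.posDef_adjoint_one hm hT⟩
  · rintro ⟨hs, h1, h2⟩
    have hk : k ≠ 0 := by
      rintro rfl
      obtain rfl : m = 1 := by simpa using hkm
      rw [Subsingleton.elim (1 : Matrix (Fin 0) (Fin 0) ℂ) 0, map_zero] at h1
      exact lt_irrefl _ (h1.diag_pos (i := 0))
    have hm : m ≠ 0 := by
      rintro rfl
      obtain rfl : k = 1 := by simpa using hkm
      rw [Subsingleton.elim (1 : Matrix (Fin 0) (Fin 0) ℂ) 0, map_zero] at h2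
      exact lt_irrefl _ (h2.diag_pos (i := 0))
    have := NeZero.mk hk
    have := NeZero.mk hm
    exact hs.exists_isDoublyStochastic hkm hT
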